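/- Let $\mathbb{K}=\mathbb{R}$ or $\mathbb{K}=\mathbb{C}$ and let $n\ge 0$ be an integer. Let $T_n(\mathbb{K})$ be the semigroup, under matrix multiplication, of all $n\times n$ lower triangular matrices with entries in $\mathbb{K}$ (singular matrices included), with the usual (entrywise) topology. Then there exist $n+1$ matrices in $T_n(\mathbb{K})$ such that the subsemigroup they generate, i.e. the set of all nonempty finite products of these matrices, is dense in $T_n(\mathbb{K})$; and $n+1$ is the least number of generators possible: no subsemigroup of $T_n(\mathbb{K})$ generated by fewer than $n+1$ matrices is dense in $T_n(\mathbb{K})$. Likewise, $n+1$ is the least number of generators of a dense subsemigroup of the semigroup of all $n\times n$ diagonal matrices with entries in $\mathbb{K}$. -/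

import Mathlib

/-- The semigroup (under matrix multiplication) of `n × n` lower triangular matrices over `K`. -/
def lowerTriangularMatrices (K : Type*) [Semiring K] (n : ℕ) :
    Subsemigroup (Matrix (Fin n) (Fin n) K) where
  carrier := {M | M.IsLowerTriangular}
  mul_mem' hA hB := Matrix.BlockTriangular.mul hA hB

/-- The semigroup (under matrix multiplication) of `n × n` diagonal matrices over `K`. -/
def diagonalMatrices (K : Type*) [Semiring K] (n : ℕ) :
    Subsemigroup (Matrix (Fin n) (Fin n) K) where
  carrier := {M | M.IsDiag}
  mul_mem' {A B} hA hB := by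
    intro i j hij
    rw [Matrix.mul_apply]
    refine Finset.sum_eq_zero fun k _ => ?_
    by_cases hik : i = k
    · subst hik
      rw [hB hij, mul_zero]
    · rw [hA hik, zero_mul]

/-- The topological semigroup `S` has a dense subsemigroup generated by (at most) `k` elements.
The generated subsemigroup consists of the nonempty finite products of generators. -/
def HasDenseSubsemigroupGeneratedBy (S : Type*) [Mul S] [TopologicalSpace S] (k : ℕ) : Prop :=
  ∃ A : Fin k → S, Dense (Subsemigroup.closure (Set.range A) : Set S)

/-!
Lower bound. Taking logarithms of absolute values of the diagonal entries sends the invertible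
diagonal matrices to `ℝⁿ`, products to sums. For at most `n` vectors in `ℝⁿ` there is a nonzero
linear functional that is nonnegative on all of them
(`exists_ne_zero_forall_dotProduct_nonneg`), so the invertible products of at most `n` generators
all lie over a closed half-space and miss a nonempty open set of diagonal matrices. The diagonal
part is a continuous surjective homomorphism from lower triangular to diagonal matrices, so the
lower bound passes to lower triangular matrices, and conversely `n + 1` generators for the
triangular matrices give `n + 1` generators for the diagonal ones.

Construction. First, there are `n + 1` vectors `d, A₁, …, Aₙ` in `(Kˣ)ⁿ` whose monomials
`d ^ k₀ * A₁ ^ k₁ * ⋯ * Aₙ ^ kₙ` are dense in `Kⁿ`, where `d` and some monomial in the `Aᵢ` have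
strictly decreasing absolute values (`exists_dense_diagonal_semigroup`). This is a Baire category
argument. On the open set of generators whose real logarithms satisfy a linear relation with
positive coefficients, there are large exponents for which the monomial is, in logarithmic
coordinates, at bounded distance from a prescribed target; a perturbation of `d` inversely
proportional to the exponent `k₀` then makes the monomial hit the target.

Now let `P` be the lower triangular matrix with ones on the diagonal and the subdiagonal and zeros
elsewhere, and take as generators `B = P * diagonal d * P⁻¹` and the matrices `diagonal (A i)`. Let
`S` be the closure of the semigroup that they generate. Because `|d|` is strictly decreasing,
conjugating a lower unitriangular matrix by `diagonal (d ^ k)` contracts it to `1`, so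
`B ^ k * diagonal (d ^ k)⁻¹ → P`. Multiplying `B ^ k` by a monomial in the `Aᵢ` chosen so that the
total diagonal converges to `x` shows that `P * diagonal x ∈ S` for every `x`. If `q` is a monomial
in the `Aᵢ` with decreasing absolute values, then
`diagonal (q ^ k) * P * diagonal (q ^ k)⁻¹ * diagonal x → diagonal x`, so `S` contains all diagonal
matrices. Conjugating `P` by diagonal matrices that contract every subdiagonal entry but one yields
in the limit the transvections in adjacent indices; commutators give all lower transvections, and
these generate all lower triangular matrices together with the diagonal ones
(`mem_of_isLowerTriangular_of_generators`).
-/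

open Filter Topology Matrix

/-! ### Exponential coordinates on the nonzero scalars -/

/-- An exponential map on `K`, for `K = ℝ` and `K = ℂ` at once. Since `RCLike.I = 0` when `K = ℝ`,
the periodicity is vacuous there; the sign `(-1) ^ s` is needed for the negative reals. -/
theorem RCLike.exists_exp_like (K : Type*) [RCLike K] :
    ∃ e : K → K, Continuous e ∧ (∀ x y, e (x + y) = e x * e y) ∧
      (∀ x, ‖e x‖ = Real.exp (RCLike.re x)) ∧
      (∀ m : ℤ, e (m * (2 * (Real.pi : K) * RCLike.I)) = 1) ∧
      ∀ z : K, z ≠ 0 → ∃ (s : ℕ) (x : K), z = (-1) ^ s * e x := by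
  refine ⟨fun z => (Real.exp (RCLike.re z) : K) *
    ((Real.cos (RCLike.im z) : K) + (Real.sin (RCLike.im z) : K) * RCLike.I), ?_, ?_, ?_, ?_, ?_⟩
  · fun_prop
  · intro x y
    have hI : (Real.sin (RCLike.im x) : K) * RCLike.I * ((Real.sin (RCLike.im y) : K) * RCLike.I) =
        - ((Real.sin (RCLike.im x) : K) * (Real.sin (RCLike.im y) : K)) := by
      rcases RCLike.I_mul_I (K := K) with h | h
      · have hx : RCLike.im x = 0 := by rw [← RCLike.I_im, h]; simp
        simp [hx]
      · linear_combination (Real.sin (RCLike.im x) : K) * (Real.sin (RCLike.im y) : K) * h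
    simp only [map_add, Real.exp_add, Real.cos_add, Real.sin_add, RCLike.ofReal_mul,
      RCLike.ofReal_sub]
    linear_combination (-(Real.exp (RCLike.re x) : K) * (Real.exp (RCLike.re y) : K)) * hI
  · intro x
    rw [norm_mul, RCLike.norm_ofReal, abs_of_pos (Real.exp_pos _)]
    suffices h : ‖(Real.cos (RCLike.im x) : K) + (Real.sin (RCLike.im x) : K) * RCLike.I‖ ^ 2 = 1 by
      rw [(pow_eq_one_iff_of_nonneg (norm_nonneg _) two_ne_zero).1 h, mul_one]
    rw [RCLike.norm_sq_eq_def]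
    rcases RCLike.I_eq_zero_or_im_I_eq_one (K := K) with h | h
    · have hx : RCLike.im x = 0 := by rw [← RCLike.I_im, h]; simp
      simp [hx]
    · simp [h]
      nlinarith [Real.sin_sq_add_cos_sq (RCLike.im x)]
  · intro m
    have h1 : RCLike.re ((m : K) * (2 * (Real.pi : K) * RCLike.I)) = 0 := by
      have : (m : K) * (2 * (Real.pi : K) * RCLike.I) =
        ((m * (2 * Real.pi) : ℝ) : K) * RCLike.I := by push_cast; ring
      rw [this, RCLike.re_ofReal_mul]; simp
    have h2 : RCLike.im ((m : K) * (2 * (Real.pi : K) * RCLike.I)) =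
        m * (2 * Real.pi) * RCLike.im (RCLike.I : K) := by
      have : (m : K) * (2 * (Real.pi : K) * RCLike.I) =
        ((m * (2 * Real.pi) : ℝ) : K) * RCLike.I := by push_cast; ring
      rw [this, RCLike.im_ofReal_mul]
    simp only [h1, h2]
    rcases RCLike.I_eq_zero_or_im_I_eq_one (K := K) with h | h
    · simp [h]
    · have hs : Real.sin (m * (2 * Real.pi)) = 0 := by
        simpa using Real.sin_add_int_mul_two_pi 0 m
      simp [h, hs, Real.cos_int_mul_two_pi]
  · intro z hz
    rcases RCLike.I_eq_zero_or_im_I_eq_one (K := K) with h | h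
    · have him : ∀ x : K, RCLike.im x = 0 := fun x => by rw [← RCLike.I_im, h]; simp
      have hzr : (RCLike.re z : K) = z := by
        conv_rhs => rw [← RCLike.re_add_im z]
        simp [h]
      have hne : RCLike.re z ≠ 0 := fun h0 => hz (by rw [← hzr, h0]; simp)
      refine ⟨if RCLike.re z < 0 then 1 else 0, (Real.log (RCLike.re z) : K), ?_⟩
      conv_lhs => rw [← hzr]
      split_ifs with hneg
      · simp [h, Real.exp_log_of_neg hneg]
      · simp [h, Real.exp_log (lt_of_le_of_ne (not_lt.1 hneg) hne.symm)]
    · set w : ℂ := ⟨RCLike.re z, RCLike.im z⟩ with hw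
      have hw0 : w ≠ 0 := by
        intro h0
        apply hz
        rw [Complex.ext_iff] at h0
        exact RCLike.ext (by simpa [hw] using h0.1) (by simpa [hw] using h0.2)
      have hpos : 0 < ‖w‖ := norm_pos_iff.2 hw0
      refine ⟨0, (Real.log ‖w‖ : K) + (Complex.arg w : K) * RCLike.I, ?_⟩
      have h1 : RCLike.re ((Real.log ‖w‖ : K) + (Complex.arg w : K) * RCLike.I) = Real.log ‖w‖ := by
        simp
      have h2 : RCLike.im ((Real.log ‖w‖ : K) + (Complex.arg w : K) * RCLike.I) = Complex.arg w := by
        simp [h]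
      simp only [h1, h2]
      rw [Real.exp_log hpos, pow_zero, one_mul, mul_add, ← mul_assoc, ← RCLike.ofReal_mul,
        ← RCLike.ofReal_mul, Complex.norm_mul_cos_arg, Complex.norm_mul_sin_arg, RCLike.re_add_im]

theorem RCLike.norm_le_abs_re_add_abs_im {K : Type*} [RCLike K] (z : K) :
    ‖z‖ ≤ |RCLike.re z| + |RCLike.im z| := by
  refine (sq_le_sq₀ (norm_nonneg _) (by positivity)).1 ?_
  rw [RCLike.norm_sq_eq_def]
  nlinarith [abs_mul_abs_self (RCLike.re z), abs_mul_abs_self (RCLike.im z),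
    mul_nonneg (abs_nonneg (RCLike.re z)) (abs_nonneg (RCLike.im z))]

/-! ### Dense semigroups of diagonal matrices -/

/-- If the real parts of the vectors `v, W₁, …, Wₙ` satisfy a linear relation with positive
coefficients, then an arbitrarily small change of `v` alone allows any target `x` to be written as a
natural number combination of the vectors, up to `2πi ℤⁿ` and with prescribed parities of the
coefficients of the `Wᵢ`. The coefficients are large multiples of those of the relation, rounded:
the error stays bounded, and is absorbed into `v` after division by its large coefficient. -/
theorem exists_natCast_relation_near {K : Type*} [RCLike K] {n : ℕ} (v : Fin n → K)
    (W : Fin n → Fin n → K) {a : ℝ} {l : Fin n → ℝ} (ha : 0 < a) (hl : ∀ i, 0 < l i)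
    (hrel : ∀ j, a * RCLike.re (v j) + ∑ i, l i * RCLike.re (W i j) = 0)
    (x : Fin n → K) (s : Fin n → ℕ) {ε : ℝ} (hε : 0 < ε) :
    ∃ (v' : Fin n → K) (k₀ : ℕ) (k : Fin n → ℕ) (m : Fin n → ℤ), dist v' v < ε ∧
      (∀ i, ∃ t, k i = 2 * t + s i) ∧
      ∀ j, k₀ * v' j + ∑ i, k i * W i j = x j + m j * (2 * (Real.pi : K) * RCLike.I) := by
  -- `c j` bounds the error in coordinate `j` independently of the scaling factor `N` below.
  set c : Fin n → ℝ := fun j => 2 * |RCLike.re (v j)| + ∑ i, (2 + s i) * |RCLike.re (W i j)| +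
    |RCLike.re (x j)| + Real.pi with hc
  have hc0 : ∀ j, 0 ≤ c j := fun j => by have := Real.pi_pos; positivity
  obtain ⟨N, hN⟩ := exists_nat_gt ((∑ j, c j) / (2 * a * ε))
  have hNpos : (0 : ℝ) < N := lt_of_le_of_lt (by have := Finset.sum_nonneg (fun j (_ : j ∈ Finset.univ) => hc0 j); positivity) hN
  set k₀ : ℕ := 2 * ⌈a * N⌉₊ with hk₀
  set k : Fin n → ℕ := fun i => 2 * ⌈l i * N⌉₊ + s i with hk
  have hk₀1 : 2 * (a * N) ≤ k₀ := by
    rw [hk₀]; push_cast; linarith [Nat.le_ceil (a * N)]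
  have hk₀2 : (k₀ : ℝ) ≤ 2 * (a * N) + 2 := by
    rw [hk₀]; push_cast; linarith [Nat.ceil_lt_add_one (mul_pos ha hNpos).le]
  have hk1 : ∀ i, 2 * (l i * N) ≤ k i := fun i => by
    simp only [hk]; push_cast
    linarith [Nat.le_ceil (l i * N), Nat.cast_nonneg (α := ℝ) (s i)]
  have hk2 : ∀ i, (k i : ℝ) ≤ 2 * (l i * N) + (2 + s i) := fun i => by
    simp only [hk]; push_cast
    linarith [Nat.ceil_lt_add_one (mul_pos (hl i) hNpos).le]
  have hk₀pos : (0 : ℝ) < k₀ := lt_of_lt_of_le (by positivity) hk₀1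
  set T : Fin n → K := fun j => k₀ * v j + ∑ i, k i * W i j - x j with hT
  set m : Fin n → ℤ := fun j => round (RCLike.im (T j) / (2 * Real.pi)) with hm
  set y : Fin n → K := fun j => T j - m j * (2 * (Real.pi : K) * RCLike.I) with hy
  have hyI : ∀ j, y j = T j - ((m j * (2 * Real.pi) : ℝ) : K) * RCLike.I := fun j => by
    simp only [hy]; push_cast; ring
  have hre : ∀ j, |RCLike.re (y j)| ≤ c j - Real.pi := by
    intro j
    have h1 : RCLike.re (y j) = (k₀ - 2 * (a * N)) * RCLike.re (v j) +
        ∑ i, (k i - 2 * (l i * N)) * RCLike.re (W i j) - RCLike.re (x j) := by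
      have h2 : RCLike.re (y j) = k₀ * RCLike.re (v j) + ∑ i, k i * RCLike.re (W i j)
          - RCLike.re (x j) := by
        rw [hyI, map_sub, RCLike.re_ofReal_mul, RCLike.I_re, hT]
        have h4 : ∀ (p : ℕ) (z : K), RCLike.re (p * z) = p * RCLike.re z := fun p z => by
          rw [← RCLike.ofReal_natCast, RCLike.re_ofReal_mul]
        simp [h4]
      have h3 : ∑ i, (k i - 2 * (l i * N)) * RCLike.re (W i j) =
          ∑ i, k i * RCLike.re (W i j) - 2 * N * ∑ i, l i * RCLike.re (W i j) := by
        rw [Finset.mul_sum, ← Finset.sum_sub_distrib]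
        exact Finset.sum_congr rfl fun i _ => by ring
      rw [h2, h3]
      linear_combination (2 * N) * hrel j
    have h4 : |(k₀ - 2 * (a * N)) * RCLike.re (v j)| ≤ 2 * |RCLike.re (v j)| := by
      rw [abs_mul, abs_of_nonneg (by linarith)]
      gcongr; linarith
    have h5 : |∑ i, (k i - 2 * (l i * N)) * RCLike.re (W i j)| ≤
        ∑ i, (2 + s i) * |RCLike.re (W i j)| := by
      refine (Finset.abs_sum_le_sum_abs _ _).trans (Finset.sum_le_sum fun i _ => ?_)
      rw [abs_mul, abs_of_nonneg (by linarith [hk1 i])]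
      gcongr; linarith [hk2 i]
    rw [h1, hc]
    have h6 := abs_sub ((k₀ - 2 * (a * N)) * RCLike.re (v j) +
        ∑ i, (k i - 2 * (l i * N)) * RCLike.re (W i j)) (RCLike.re (x j))
    have h7 := abs_add_le ((k₀ - 2 * (a * N)) * RCLike.re (v j))
        (∑ i, (k i - 2 * (l i * N)) * RCLike.re (W i j))
    simp only
    linarith
  have him : ∀ j, |RCLike.im (y j)| ≤ Real.pi := by
    intro j
    have hpi := Real.pi_pos
    rcases RCLike.I_eq_zero_or_im_I_eq_one (K := K) with h | h
    · have : RCLike.im (y j) = 0 := by rw [← RCLike.I_im, h]; simp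
      rw [this]; simpa using hpi.le
    · rw [hyI, map_sub, RCLike.im_ofReal_mul, h, mul_one]
      have h1 := abs_sub_round (RCLike.im (T j) / (2 * Real.pi))
      have h2 : RCLike.im (T j) - m j * (2 * Real.pi) =
          (RCLike.im (T j) / (2 * Real.pi) - m j) * (2 * Real.pi) := by field_simp
      rw [h2, abs_mul, abs_of_pos (by positivity : 0 < 2 * Real.pi)]
      calc _ ≤ 1 / 2 * (2 * Real.pi) := by gcongr
        _ = Real.pi := by ring
  have hny : ∀ j, ‖y j‖ ≤ c j := fun j =>
    (RCLike.norm_le_abs_re_add_abs_im (y j)).trans (by linarith [hre j, him j])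
  have hk₀K : (k₀ : K) ≠ 0 := by
    have : k₀ ≠ 0 := by rintro h0; rw [h0] at hk₀pos; simp at hk₀pos
    exact_mod_cast this
  refine ⟨fun j => v j - y j / k₀, k₀, k, m, ?_, fun i => ⟨_, rfl⟩, fun j => ?_⟩
  · rw [dist_pi_lt_iff hε]
    intro j
    rw [dist_eq_norm, sub_sub_cancel_left, norm_neg, norm_div, RCLike.norm_natCast,
      div_lt_iff₀ hk₀pos]
    rw [div_lt_iff₀ (by positivity)] at hN
    calc ‖y j‖ ≤ ∑ j, c j := (hny j).trans (Finset.single_le_sum (fun j _ => hc0 j) (Finset.mem_univ j))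
      _ < N * (2 * a * ε) := hN
      _ = ε * (2 * (a * N)) := by ring
      _ ≤ ε * k₀ := by gcongr
  · rw [mul_sub, mul_div_cancel₀ _ hk₀K]
    simp only [hy, hT]
    ring

/-- The two monotonicity conditions are what makes conjugation by powers of `d`, and of a suitable
monomial in the `A i`, contract lower unitriangular matrices. -/
theorem exists_dense_diagonal_semigroup (K : Type*) [RCLike K] (n : ℕ) :
    ∃ (d : Fin n → K) (A : Fin n → Fin n → K), (∀ i, d i ≠ 0) ∧ (StrictAnti fun i => ‖d i‖) ∧
      (∀ i j, A i j ≠ 0) ∧ (∃ m : Fin n → ℕ, StrictAnti fun j => ‖(∏ i, A i ^ m i) j‖) ∧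
      Dense (Set.range fun k : ℕ × (Fin n → ℕ) => d ^ k.1 * ∏ i, A i ^ k.2 i) := by
  obtain ⟨e, he, hadd, hnorm, hper, hsurj⟩ := RCLike.exists_exp_like K
  have hne : ∀ x, e x ≠ 0 := fun x => by
    rw [← norm_ne_zero_iff, hnorm]; exact (Real.exp_pos _).ne'
  have he0 : e 0 = 1 := by
    have := hadd 0 0
    rw [add_zero] at this
    exact (mul_eq_left₀ (hne 0)).1 this.symm
  have hpow : ∀ (k : ℕ) x, e x ^ k = e (k * x) := by
    intro k x
    induction k with
    | zero => simp [he0]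
    | succ k ih => rw [pow_succ, ih, ← hadd]; push_cast; ring_nf
  have hsum : ∀ (s : Finset (Fin n)) (f : Fin n → K), ∏ i ∈ s, e (f i) = e (∑ i ∈ s, f i) := by
    intro s f
    induction s using Finset.induction_on with
    | empty => simp [he0]
    | insert i s hi ih => rw [Finset.prod_insert hi, Finset.sum_insert hi, ih, hadd]
  -- Generators are parametrized by their logarithms. The sign on the diagonal of `gen` makes the
  -- parity of `k j` control the sign of coordinate `j`, which is needed when `K = ℝ`.
  let gen₀ : (Fin n → K) × (Fin n → Fin n → K) → Fin n → K := fun x j => e (x.1 j)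
  let gen : (Fin n → K) × (Fin n → Fin n → K) → Fin n → Fin n → K :=
    fun x i j => (if i = j then -1 else 1) * e (x.2 i j)
  let word : ℕ × (Fin n → ℕ) → (Fin n → K) × (Fin n → Fin n → K) → Fin n → K :=
    fun k x => gen₀ x ^ k.1 * ∏ i, gen x i ^ k.2 i
  have hword : ∀ k x j, word k x j = (-1) ^ k.2 j * e (k.1 * x.1 j + ∑ i, k.2 i * x.2 i j) := by
    intro k x j
    simp only [word, gen₀, gen, Pi.mul_apply, Pi.pow_apply, Finset.prod_apply, mul_pow,
      Finset.prod_mul_distrib, hpow, hsum, hadd]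
    rw [Finset.prod_eq_single j (by intro b _ hb; simp [hb]) (by simp)]
    simp only [if_true]
    ring
  have hwordc : ∀ k, Continuous (word k) := by
    intro k
    refine continuous_pi fun j => ?_
    simp only [hword]
    fun_prop
  let M : (Fin n → K) × (Fin n → Fin n → K) → Matrix (Fin n) (Fin n) ℝ :=
    fun x => Matrix.of fun j i => RCLike.re (x.2 i j)
  let c : (Fin n → K) × (Fin n → Fin n → K) → Fin n → ℝ :=
    fun x => Matrix.cramer (M x) fun j => - RCLike.re (x.1 j)
  have hMc : Continuous M := by
    refine continuous_matrix fun i j => ?_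
    simp only [M, Matrix.of_apply]
    fun_prop
  have hcc : Continuous c := by
    refine hMc.matrix_cramer ?_
    fun_prop
  -- The first two conditions give a positive linear relation between the real logarithms, by
  -- Cramer's rule; written with determinants they are visibly open. The last two are the
  -- monotonicity of `d` and of the monomial with exponents `n - l`.
  let R : Set ((Fin n → K) × (Fin n → Fin n → K)) :=
    {x | 0 < (M x).det} ∩ (⋂ i, {x | 0 < c x i}) ∩
      (⋂ i : Fin n, ⋂ j : Fin n, ⋂ _ : i < j, {x | RCLike.re (x.1 j) < RCLike.re (x.1 i)} ∩
        {x | ∑ l : Fin n, ((n - l : ℕ) : ℝ) * RCLike.re (x.2 l j) <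
          ∑ l : Fin n, ((n - l : ℕ) : ℝ) * RCLike.re (x.2 l i)})
  have hRo : IsOpen R := by
    refine ((isOpen_lt continuous_const hMc.matrix_det).inter
      (isOpen_iInter_of_finite fun i => isOpen_lt continuous_const (by fun_prop))).inter
      (isOpen_iInter_of_finite fun i => isOpen_iInter_of_finite fun j =>
        isOpen_iInter_of_finite fun _ => (isOpen_lt ?_ ?_).inter (isOpen_lt ?_ ?_))
    all_goals fun_prop
  have hRne : R.Nonempty := by
    let x : (Fin n → K) × (Fin n → Fin n → K) :=
      ⟨fun j => -(((j : ℕ) + 1 : ℝ) : K), fun i j => if i = j then 1 else 0⟩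
    have hre : ∀ i j, RCLike.re (x.2 i j) = if i = j then 1 else 0 := by
      intro i j
      simp only [x]
      split_ifs <;> simp
    have hre' : ∀ j, RCLike.re (x.1 j) = -((j : ℕ) + 1 : ℝ) := fun j => by
      simp only [x, ← RCLike.ofReal_neg, RCLike.ofReal_re]
    have hM1 : M x = 1 := by
      ext j i
      simp only [M, Matrix.of_apply, hre, Matrix.one_apply, eq_comm]
    refine ⟨x, ⟨?_, Set.mem_iInter.2 fun i => ?_⟩, Set.mem_iInter.2 fun i =>
      Set.mem_iInter.2 fun j => Set.mem_iInter.2 fun hij => ⟨?_, ?_⟩⟩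
    · simp [hM1]
    · simp only [Set.mem_ofPred_eq, c, hM1, Matrix.cramer_one, hre']
      simp only [Module.End.one_apply, neg_neg]
      positivity
    · have h : ((i : ℕ) : ℝ) < (j : ℕ) := by exact_mod_cast hij
      simp only [Set.mem_ofPred_eq, hre']
      linarith
    · have h : (i : ℕ) < j := hij
      simp only [Set.mem_ofPred_eq, hre, mul_ite, mul_one, mul_zero, Finset.sum_ite_eq',
        Finset.mem_univ, if_true]
      exact_mod_cast (by omega : n - (j : ℕ) < n - i)
  have hRrel : ∀ x ∈ R, ∀ j, (M x).det * RCLike.re (x.1 j) +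
      ∑ i, c x i * RCLike.re (x.2 i j) = 0 := by
    intro x _ j
    have := congrFun (Matrix.mulVec_cramer (M x) fun j => - RCLike.re (x.1 j)) j
    simp only [Matrix.mulVec, dotProduct, M, Matrix.of_apply, Pi.smul_apply, smul_eq_mul] at this
    have h2 : ∑ i, c x i * RCLike.re (x.2 i j) = ∑ i, RCLike.re (x.2 i j) * c x i :=
      Finset.sum_congr rfl fun i _ => mul_comm _ _
    rw [h2]
    simp only [c, M]
    rw [this]
    ring
  -- The complement of `closure R` is added so that the open sets are dense in the whole space,
  -- where the Baire category theorem applies.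
  have hhit : ∀ U : Set (Fin n → K), IsOpen U → U.Nonempty →
      Dense ((⋃ k, word k ⁻¹' U) ∪ (closure R)ᶜ) := by
    intro U hU hUne
    rw [dense_iff_inter_open]
    intro V hV hVne
    by_cases hVR : (V ∩ R).Nonempty
    · obtain ⟨x, hxV, hxR⟩ := hVR
      obtain ⟨z, hzU, hz⟩ : ∃ z ∈ U, ∀ j, z j ≠ 0 := by
        have hd : Dense (Set.pi Set.univ fun _ : Fin n => ({0}ᶜ : Set K)) :=
          dense_pi _ fun i _ => dense_compl_singleton 0
        obtain ⟨z, hzU, hz⟩ := hd.inter_open_nonempty U hU hUne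
        exact ⟨z, hzU, fun j => hz j (Set.mem_univ j)⟩
      choose s y hsy using fun j => hsurj (z j) (hz j)
      obtain ⟨ε, hε, hεV⟩ := Metric.isOpen_iff.1 hV x hxV
      obtain ⟨v, k₀, k, m, hdist, hpar, heq⟩ := exists_natCast_relation_near x.1 x.2
        hxR.1.1 (fun i => Set.mem_iInter.1 hxR.1.2 i) (hRrel x hxR) y s hε
      refine ⟨(v, x.2), hεV ?_, Or.inl (Set.mem_iUnion.2 ⟨(k₀, k), ?_⟩)⟩
      · rw [Metric.mem_ball, Prod.dist_eq]
        simpa [hε] using hdist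
      · suffices h : word (k₀, k) (v, x.2) = z by rw [Set.mem_preimage, h]; exact hzU
        ext j
        obtain ⟨t, ht⟩ := hpar j
        rw [hword, heq, hadd, hper, mul_one, hsy j, show (k₀, k).2 j = 2 * t + s j from ht, pow_add, pow_mul]
        simp
    · obtain ⟨x, hx⟩ := hVne
      refine ⟨x, hx, Or.inr fun hxc => hVR ?_⟩
      exact mem_closure_iff.1 hxc V hV hx
  have hres : Dense (⋂ U : {U : Set (Fin n → K) // U ∈ TopologicalSpace.countableBasis (Fin n → K)},
      ((⋃ k, word k ⁻¹' U.1) ∪ (closure R)ᶜ)) := by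
    have : Countable {U : Set (Fin n → K) // U ∈ TopologicalSpace.countableBasis (Fin n → K)} :=
      (TopologicalSpace.countable_countableBasis _).to_subtype
    refine dense_iInter_of_isOpen (fun U => ?_) fun U => ?_
    · exact (isOpen_iUnion fun k => (TopologicalSpace.isOpen_of_mem_countableBasis U.2).preimage
        (hwordc k)).union isClosed_closure.isOpen_compl
    · exact hhit _ (TopologicalSpace.isOpen_of_mem_countableBasis U.2)
        (TopologicalSpace.nonempty_of_mem_countableBasis U.2)
  obtain ⟨x, hxR, hx⟩ := hres.inter_open_nonempty R hRo hRne
  have hlt : ∀ i j : Fin n, i < j → _ := fun i j hij =>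
    Set.mem_iInter.1 (Set.mem_iInter.1 (Set.mem_iInter.1 hxR.2 i) j) hij
  refine ⟨gen₀ x, gen x, fun i => hne _, ?_, fun i j => ?_, ⟨fun l => n - l, ?_⟩, ?_⟩
  · intro i j hij
    simp only [gen₀, hnorm]
    exact Real.exp_lt_exp.2 (hlt i j hij).1
  · simp only [gen]
    split_ifs <;> simp [hne]
  · intro i j hij
    have h1 : ∀ j, ‖(∏ l, gen x l ^ (n - l : ℕ)) j‖ =
        Real.exp (∑ l : Fin n, ((n - l : ℕ) : ℝ) * RCLike.re (x.2 l j)) := by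
      intro j
      have h2 := hword (0, fun l => n - l) x j
      simp only [word, pow_zero, one_mul, Nat.cast_zero, zero_mul, zero_add] at h2
      rw [h2, norm_mul, hnorm, norm_pow, norm_neg, norm_one, one_pow, one_mul, map_sum]
      congr 1
      refine Finset.sum_congr rfl fun l _ => ?_
      rw [← RCLike.ofReal_natCast, RCLike.re_ofReal_mul]
    simp only [h1]
    exact Real.exp_lt_exp.2 (hlt i j hij).2
  · rw [(TopologicalSpace.isBasis_countableBasis (Fin n → K)).dense_iff]
    intro U hU _
    rcases Set.mem_iInter.1 hx ⟨U, hU⟩ with h | h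
    · obtain ⟨k, hk⟩ := Set.mem_iUnion.1 h
      exact ⟨word k x, hk, k, rfl⟩
    · exact absurd (subset_closure hxR) h

/-! ### Contraction by diagonal conjugation -/

section
variable {K : Type*} [RCLike K] {n : ℕ}

theorem Matrix.diagonal_pi_mul (p q : Fin n → K) :
    diagonal (p * q) = diagonal p * diagonal q :=
  (diagonal_mul_diagonal p q).symm

/-- Conjugation by `diagonal (d ^ m)` multiplies the entry `(i, j)` by `(d i / d j) ^ m`. -/
theorem tendsto_diagonal_pow_conj {d : Fin n → K} (hd : ∀ i, d i ≠ 0)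
    {Q : Matrix (Fin n) (Fin n) K} (h : ∀ i j, Q i j ≠ 0 → d i = d j ∨ ‖d i‖ < ‖d j‖) :
    Tendsto (fun m : ℕ => diagonal (d ^ m) * Q * diagonal (d ^ m)⁻¹) atTop
      (𝓝 (of fun i j => if d i = d j then Q i j else 0)) := by
  refine tendsto_pi_nhds.2 fun i => tendsto_pi_nhds.2 fun j => ?_
  have heq : ∀ m : ℕ, (diagonal (d ^ m) * Q * diagonal (d ^ m)⁻¹) i j = (d i / d j) ^ m * Q i j := by
    intro m
    rw [mul_diagonal, diagonal_mul, div_pow]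
    simp only [Pi.pow_apply, Pi.inv_apply]
    ring
  simp only [heq, of_apply]
  by_cases hQ : Q i j = 0
  · simp [hQ]
  rcases h i j hQ with he | hlt
  · simp [he, hd j]
  · have hne : d i ≠ d j := fun he => by simp [he] at hlt
    have h1 : ‖d i / d j‖ < 1 := by
      rw [norm_div, div_lt_one (norm_pos_iff.2 (hd j))]; exact hlt
    simpa [hne] using (tendsto_pow_atTop_nhds_zero_of_norm_lt_one h1).mul_const (Q i j)

theorem tendsto_diagonal_pow_conj_one {d : Fin n → K} (hd : ∀ i, d i ≠ 0)
    (ha : StrictAnti fun i => ‖d i‖) {Q : Matrix (Fin n) (Fin n) K} (hQ : Q.IsLowerTriangular)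
    (h1 : ∀ i, Q i i = 1) :
    Tendsto (fun m : ℕ => diagonal (d ^ m) * Q * diagonal (d ^ m)⁻¹) atTop (𝓝 1) := by
  convert tendsto_diagonal_pow_conj hd (Q := Q) ?_ using 2
  · ext i j
    by_cases hij : i = j
    · subst hij; simp [h1]
    · have : d i ≠ d j := fun h => hij (ha.injective (by simp [h]))
      simp [hij, this]
  · intro i j hne
    rcases lt_trichotomy i j with h | h | h
    · exact absurd (hQ (OrderDual.toDual_lt_toDual.2 h)) hne
    · exact Or.inl (by rw [h])
    · exact Or.inr (ha h)

theorem Matrix.IsLowerTriangular.mul_apply_self {R : Type*} [Semiring R]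
    {A B : Matrix (Fin n) (Fin n) R}
    (hA : A.IsLowerTriangular) (hB : B.IsLowerTriangular) (i : Fin n) :
    (A * B) i i = A i i * B i i := by
  rw [mul_apply, Finset.sum_eq_single i]
  · intro j _ hj
    rcases lt_or_gt_of_ne hj with h | h
    · rw [hB (OrderDual.toDual_lt_toDual.2 h), mul_zero]
    · rw [hA (OrderDual.toDual_lt_toDual.2 h), zero_mul]
  · simp

/-! ### Generation of the lower triangular matrices -/

theorem transvection_mem_of_adjacent {S : Subsemigroup (Matrix (Fin n) (Fin n) K)}
    (hS : ∀ i j : Fin n, (i : ℕ) = j + 1 → ∀ c, transvection i j c ∈ S) {i j : Fin n} (hij : j < i)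
    (c : K) : transvection i j c ∈ S := by
  obtain ⟨p, hp⟩ : ∃ p : ℕ, (i : ℕ) = j + (p + 1) := ⟨i - j - 1, by have : (j : ℕ) < i := hij; omega⟩
  induction p generalizing i c with
  | zero => exact hS i j hp c
  | succ p ih =>
    have hlt : (j : ℕ) + (p + 1) < n := by omega
    set l : Fin n := ⟨j + (p + 1), hlt⟩ with hl
    have hjl : j < l := by rw [Fin.lt_def]; simp [hl]
    have hli : l < i := by rw [Fin.lt_def]; simp [hl]; omega
    -- The commutator of two transvections with a common middle index `l`.
    have key : transvection i j c = transvection i l c * transvection l j 1 *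
        transvection i l (-c) * transvection l j (-1) := by
      simp only [transvection, mul_add, add_mul, one_mul, mul_one, single_mul_single_same]
      simp [single_mul_single_of_ne, hjl.ne, hli.ne, hij.ne]
      have hn : ∀ (a b : Fin n) (x : K), single a b (-x) = -single a b x := fun a b x => by
        ext; simp [single_apply, neg_ite]
      simp only [hn]
      abel
    rw [key]
    have h1 : ∀ c, transvection i l c ∈ S := hS i l (by simp [hl]; omega)
    have h2 : ∀ c, transvection l j c ∈ S := fun c => ih hjl c rfl
    exact S.mul_mem (S.mul_mem (S.mul_mem (h1 _) (h2 _)) (h1 _)) (h2 _)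

/-- A lower triangular matrix `M` is the product `F₀ * F₁ * ⋯ * Fₙ₋₁`, where `Fᵢ` is the identity
matrix with row `i` replaced by that of `M`, and `Fᵢ` is a product of transvections and a diagonal
matrix. Singular matrices are included. -/
theorem mem_of_isLowerTriangular_of_transvection {S : Subsemigroup (Matrix (Fin n) (Fin n) K)}
    (hD : ∀ d, diagonal d ∈ S) (hT : ∀ i j : Fin n, j < i → ∀ c, transvection i j c ∈ S)
    {M : Matrix (Fin n) (Fin n) K} (hM : M.IsLowerTriangular) : M ∈ S := by
  have hrow : ∀ i, (of fun a b => (1 : Matrix (Fin n) (Fin n) K) a b +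
      if a = i then M i b - (1 : Matrix (Fin n) (Fin n) K) i b else 0) ∈ S := by
    intro i
    have hsum : ∀ s : Finset (Fin n), (∀ j ∈ s, j < i) →
        1 + ∑ j ∈ s, single i j (M i j) ∈ S := by
      intro s
      induction s using Finset.induction_on with
      | empty => intro _; simpa using hD 1
      | insert j s hj ih =>
        intro hs
        have h1 := S.mul_mem (ih fun l hl => hs l (Finset.mem_insert_of_mem hl))
          (hT i j (hs j (Finset.mem_insert_self j s)) (M i j))
        convert h1 using 1
        rw [transvection, mul_add, mul_one, add_mul, one_mul, Finset.sum_mul,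
          Finset.sum_eq_zero (f := fun l => single i l (M i l) * single i j (M i j)),
          Finset.sum_insert hj]
        · abel
        · intro l hl
          exact single_mul_single_of_ne _ _ _ _
            (hs l (Finset.mem_insert_of_mem hl)).ne _
    convert S.mul_mem (hsum (Finset.Iio i) (by simp)) (hD (Function.update 1 i (M i i))) using 1
    ext a b
    rw [mul_diagonal, Matrix.add_apply, Matrix.sum_apply, of_apply]
    by_cases ha : a = i
    · subst ha
      rcases lt_trichotomy a b with h | h | h
      · rw [hM (OrderDual.toDual_lt_toDual.2 h)]
        simp [single_apply, h.ne, h.ne', h.not_gt]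
      · subst h
        simp [single_apply]
      · simp [single_apply, h.ne, h.ne', h]
    · simp [ha, Ne.symm ha, Function.update_apply, one_apply]
      intro h
      subst h
      simp [ha]
  -- The product of the first `k` of these agrees with `M` in its first `k` rows.
  have hpart : ∀ k : ℕ, k ≤ n →
      (of fun a b : Fin n => if (a : ℕ) < k then M a b else (1 : Matrix (Fin n) (Fin n) K) a b) ∈ S := by
    intro k
    induction k with
    | zero => intro _; convert hD 1 using 1; ext a b; simp
    | succ k ih =>
      intro hk
      set i : Fin n := ⟨k, hk⟩ with hi
      convert S.mul_mem (ih (Nat.le_of_succ_le hk)) (hrow i) using 1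
      ext a b
      simp only [mul_apply, of_apply, mul_add, Finset.sum_add_distrib, mul_ite, mul_zero,
        Finset.sum_ite_eq', Finset.mem_univ, if_true]
      have h1 : ∑ c, (if (a : ℕ) < k then M a c else (1 : Matrix (Fin n) (Fin n) K) a c) *
          (1 : Matrix (Fin n) (Fin n) K) c b =
          if (a : ℕ) < k then M a b else (1 : Matrix (Fin n) (Fin n) K) a b := by
        simp [one_apply]
      rw [h1]
      rcases lt_trichotomy a i with h | h | h
      · have h' : (a : ℕ) < k := h
        simp [h', h'.trans (Nat.lt_succ_self k), hM (OrderDual.toDual_lt_toDual.2 h)]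
      · subst h
        simp [hi]
      · have h' : k < (a : ℕ) := h
        simp [h'.not_gt, h.ne', h'.not_ge]
  convert hpart n le_rfl using 1
  ext a b
  simp

/-- The lower bidiagonal matrix with ones on the diagonal and on the subdiagonal. -/
def unipotentBidiagonal (K : Type*) [Zero K] [One K] (n : ℕ) : Matrix (Fin n) (Fin n) K :=
  of fun i j => if i = j then 1 else if (i : ℕ) = j + 1 then 1 else 0

theorem isLowerTriangular_unipotentBidiagonal :
    (unipotentBidiagonal K n).IsLowerTriangular := by
  intro i j h
  have h' : (i : ℕ) < j := OrderDual.toDual_lt_toDual.1 h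
  have h1 : i ≠ j := by rintro rfl; simp at h'
  simp [unipotentBidiagonal, h1]
  omega

theorem unipotentBidiagonal_apply_self (i : Fin n) : unipotentBidiagonal K n i i = 1 := by
  simp [unipotentBidiagonal]

theorem isUnit_det_unipotentBidiagonal : IsUnit (unipotentBidiagonal K n).det := by
  rw [det_of_isLowerTriangular _ isLowerTriangular_unipotentBidiagonal]
  simp [unipotentBidiagonal_apply_self]

/-- The transvections in adjacent indices are limits of diagonal conjugates of
`unipotentBidiagonal K n`, up to a diagonal rescaling. -/
theorem mem_of_isLowerTriangular_of_unipotentBidiagonal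
    {S : Subsemigroup (Matrix (Fin n) (Fin n) K)} (hS : IsClosed (S : Set (Matrix (Fin n) (Fin n) K)))
    (hD : ∀ d, diagonal d ∈ S)
    (hP : ∀ d d', diagonal d * unipotentBidiagonal K n * diagonal d' ∈ S)
    {M : Matrix (Fin n) (Fin n) K} (hM : M.IsLowerTriangular) : M ∈ S := by
  refine mem_of_isLowerTriangular_of_transvection hD (fun i j hij c =>
    transvection_mem_of_adjacent (fun i j hij c => ?_) hij c) hM
  have hne : j ≠ i := by rintro rfl; omega
  have hone : transvection i j (1 : K) ∈ S := by
    -- The weight increases at each step except from `j` to `i`, so conjugation by powers of `d`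
    -- fixes the entry `(i, j)` and contracts the other subdiagonal entries.
    set w : Fin n → ℕ := fun a => if (a : ℕ) ≤ j then a else a - 1 with hw
    set d : Fin n → K := fun a => (2 : K)⁻¹ ^ w a with hd
    have hd0 : ∀ a, d a ≠ 0 := fun a => pow_ne_zero _ (by norm_num)
    have hlt : ∀ a b, w b < w a → ‖d a‖ < ‖d b‖ := by
      intro a b h
      simp only [hd, norm_pow, norm_inv, RCLike.norm_ofNat]
      exact pow_lt_pow_right_of_lt_one₀ (by norm_num) (by norm_num) h
    have hlim := tendsto_diagonal_pow_conj hd0 (Q := unipotentBidiagonal K n) (by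
      intro a b hab
      by_cases h : a = b
      · exact Or.inl (by rw [h])
      have h1 : (a : ℕ) = b + 1 := by
        by_contra h1
        simp [unipotentBidiagonal, h, h1] at hab
      rcases lt_trichotomy (b : ℕ) j with h2 | h2 | h2
      · exact Or.inr (hlt _ _ (by simp only [hw]; split_ifs <;> omega))
      · exact Or.inl (by
          have : w a = w b := by simp only [hw]; split_ifs <;> omega
          simp only [hd, this])
      · exact Or.inr (hlt _ _ (by simp only [hw]; split_ifs <;> omega)))
    convert (show _ ∈ S from hS.mem_of_tendsto hlim (Eventually.of_forall fun m => hP _ _)) using 1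
    ext a b
    by_cases h : a = b
    · subst h
      have : ¬ (i = a ∧ j = a) := fun h => hne (h.2.trans h.1.symm)
      simp [transvection, unipotentBidiagonal, this]
    by_cases h1 : (a : ℕ) = b + 1
    · by_cases h2 : b = j
      · subst h2
        have h3 : a = i := Fin.ext (by omega)
        subst h3
        have : w a = w b := by simp only [hw]; split_ifs <;> omega
        simp [transvection, unipotentBidiagonal, h, h1, hd, this]
      · have h3 : (b : ℕ) ≠ j := fun h => h2 (Fin.ext h)
        have h4 : ‖d a‖ < ‖d b‖ := hlt _ _ (by simp only [hw]; split_ifs <;> omega)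
        have h5 : d a ≠ d b := fun h => by simp [h] at h4
        simp [transvection, h, h5, Ne.symm h2]
    · have : ¬ (i = a ∧ j = b) := by rintro ⟨rfl, rfl⟩; exact h1 hij
      simp [transvection, unipotentBidiagonal, h, h1, this]
  by_cases hc : c = 0
  · subst hc
    simpa using hD 1
  · convert S.mul_mem (S.mul_mem (hD (Function.update 1 i c)) hone)
      (hD (Function.update 1 i c⁻¹)) using 1
    ext a b
    rw [mul_diagonal, diagonal_mul]
    by_cases ha : a = i
    · subst ha
      by_cases hb : b = a
      · subst hb; simp [transvection, hne, hc]
      · simp [transvection, single_apply, hb, Ne.symm hb]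
    · by_cases hb : b = i
      · subst hb; simp [transvection, ha, Ne.symm ha]
      · simp [transvection, ha, hb, Ne.symm ha]

/-! ### The closed semigroup containing the generators -/

/-- A closed semigroup containing one conjugated and `n` diagonal generators contains every lower
triangular matrix, provided that the monomials in the eigenvalues are dense. -/
theorem mem_of_isLowerTriangular_of_generators
    {S : Subsemigroup (Matrix (Fin n) (Fin n) K)} (hS : IsClosed (S : Set (Matrix (Fin n) (Fin n) K)))
    {d : Fin n → K} {A : Fin n → Fin n → K} (hd : ∀ i, d i ≠ 0) (hda : StrictAnti fun i => ‖d i‖)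
    (hA : ∀ i j, A i j ≠ 0) (hAa : ∃ m : Fin n → ℕ, StrictAnti fun j => ‖(∏ i, A i ^ m i) j‖)
    (hdense : Dense (Set.range fun k : ℕ × (Fin n → ℕ) => d ^ k.1 * ∏ i, A i ^ k.2 i))
    (hB : unipotentBidiagonal K n * diagonal d * (unipotentBidiagonal K n)⁻¹ ∈ S)
    (hAS : ∀ i, diagonal (A i) ∈ S)
    {M : Matrix (Fin n) (Fin n) K} (hM : M.IsLowerTriangular) : M ∈ S := by
  set P := unipotentBidiagonal K n with hPdef
  have hPu : IsUnit P.det := isUnit_det_unipotentBidiagonal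
  have hPl : P.IsLowerTriangular := isLowerTriangular_unipotentBidiagonal
  have : Invertible P := P.invertibleOfIsUnitDet hPu
  have hPil : P⁻¹.IsLowerTriangular := blockTriangular_inv_of_blockTriangular hPl
  have hPi1 : ∀ i, P⁻¹ i i = 1 := by
    intro i
    have h1 := hPl.mul_apply_self hPil i
    rw [mul_nonsing_inv _ hPu, one_apply_eq, hPdef, unipotentBidiagonal_apply_self, one_mul] at h1
    exact h1.symm
  -- The identity matrix is not yet known to lie in `S`, so monomials in the `A i`, which may be
  -- empty, are recorded through their action on `S`.
  let N : Submonoid (Fin n → K) :=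
    { carrier := {q | ∀ X ∈ S, diagonal q * X ∈ S ∧ X * diagonal q ∈ S}
      one_mem' := fun X hX => by simpa using hX
      mul_mem' := fun {p q} hp hq X hX => by
        rw [diagonal_pi_mul, Matrix.mul_assoc, ← Matrix.mul_assoc X]
        exact ⟨(hp _ (hq X hX).1).1, (hq _ (hp X hX).2).2⟩ }
  have hAN : ∀ i, A i ∈ N := fun i X hX => ⟨S.mul_mem (hAS i) hX, S.mul_mem hX (hAS i)⟩
  have hprod : ∀ m : Fin n → ℕ, ∏ i, A i ^ m i ∈ N := fun m =>
    N.prod_mem fun i _ => N.pow_mem (hAN i) _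
  have hpow : ∀ k, (P * diagonal d * P⁻¹) ^ (k + 1) ∈ S := by
    intro k
    induction k with
    | zero => simpa using hB
    | succ k ih => rw [pow_succ]; exact S.mul_mem ih hB
  have hpow' : ∀ k, (P * diagonal d * P⁻¹) ^ k = P * diagonal (d ^ k) * P⁻¹ := by
    intro k
    induction k with
    | zero => simp [mul_nonsing_inv _ hPu]
    | succ k ih =>
      rw [pow_succ, ih, pow_succ, diagonal_pi_mul]
      simp only [Matrix.mul_assoc]
      rw [nonsing_inv_mul_cancel_left _ _ hPu]
  have hword : ∀ x : Fin n → K, P * diagonal x ∈ S := by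
    intro x
    -- Density persists for exponents of `d` at least `N + 1`, because `d ^ (N + 1)` is invertible.
    have hex : ∀ N : ℕ, ∃ k : ℕ × (Fin n → ℕ),
        dist (d ^ (N + 1 + k.1) * ∏ i, A i ^ k.2 i) x < 1 / ((N : ℝ) + 1) := by
      intro N
      have hcont : Continuous fun y : Fin n → K => d ^ (N + 1) * y := by fun_prop
      obtain ⟨_, h, k, rfl⟩ := hdense.inter_open_nonempty _
        (Metric.isOpen_ball.preimage hcont) ⟨(d ^ (N + 1))⁻¹ * x, by
          rw [Set.mem_preimage, Metric.mem_ball]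
          have : d ^ (N + 1) * ((d ^ (N + 1))⁻¹ * x) = x := by
            ext i; simp [hd i]
          rw [this, dist_self]
          exact Nat.one_div_pos_of_nat (n := N)⟩
      refine ⟨k, ?_⟩
      rw [Set.mem_preimage, Metric.mem_ball] at h
      rwa [pow_add, mul_assoc]
    choose k hk using hex
    have h1 : Tendsto (fun N : ℕ => d ^ (N + 1 + (k N).1) * ∏ i, A i ^ (k N).2 i) atTop (𝓝 x) := by
      rw [tendsto_iff_dist_tendsto_zero]
      exact squeeze_zero (fun _ => dist_nonneg) (fun N => (hk N).le)
        tendsto_one_div_add_atTop_nhds_zero_nat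
    have h2 : Tendsto (fun N : ℕ => N + 1 + (k N).1) atTop atTop :=
      tendsto_atTop_mono (fun N => by simp only [id]; omega) tendsto_id
    have h3 := (tendsto_diagonal_pow_conj_one hd hda hPil hPi1).comp h2
    have h4 : Tendsto (fun N : ℕ => diagonal (d ^ (N + 1 + (k N).1) * ∏ i, A i ^ (k N).2 i)) atTop
        (𝓝 (diagonal x)) := (Continuous.matrix_diagonal continuous_id).continuousAt.tendsto.comp h1
    have h5 := (h3.const_mul P).mul h4
    rw [mul_one] at h5
    refine hS.mem_of_tendsto h5 (Eventually.of_forall fun m => ?_)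
    change _ ∈ S
    convert (hprod (k m).2 _ (hpow (m + (k m).1))).2 using 1
    rw [show m + (k m).1 + 1 = m + 1 + (k m).1 by ring, hpow', diagonal_pi_mul]
    simp only [Function.comp_apply, Matrix.mul_assoc]
    congr 3
    rw [← Matrix.mul_assoc, ← diagonal_pi_mul]
    convert Matrix.one_mul _
    rw [← diagonal_one]
    congr 1
    ext i; simp [hd i]
  have hD : ∀ x, diagonal x ∈ S := by
    intro x
    obtain ⟨m, hm⟩ := hAa
    set q := ∏ i, A i ^ m i with hq
    have hq0 : ∀ j, q j ≠ 0 := fun j => by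
      simp [hq, Finset.prod_apply, Finset.prod_ne_zero_iff, hA]
    have h1 := (tendsto_diagonal_pow_conj_one hq0 hm hPl unipotentBidiagonal_apply_self).mul_const
      (diagonal x)
    rw [one_mul] at h1
    refine hS.mem_of_tendsto h1 (Eventually.of_forall fun k => ?_)
    rw [Matrix.mul_assoc, Matrix.mul_assoc, ← diagonal_pi_mul]
    exact (N.pow_mem (hprod m) k _ (hword _)).1
  refine mem_of_isLowerTriangular_of_unipotentBidiagonal hS hD (fun x y => ?_) hM
  rw [Matrix.mul_assoc]
  exact S.mul_mem (hD x) (hword y)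

end

/-! ### The lower bound for diagonal matrices -/

theorem HasDenseSubsemigroupGeneratedBy.of_surjective {S T : Type*} [Mul S] [Mul T]
    [TopologicalSpace S] [TopologicalSpace T] {k : ℕ} (h : HasDenseSubsemigroupGeneratedBy S k)
    (f : S →ₙ* T) (hf : Continuous f) (hs : Function.Surjective f) :
    HasDenseSubsemigroupGeneratedBy T k := by
  obtain ⟨A, hA⟩ := h
  refine ⟨f ∘ A, ?_⟩
  rw [Set.range_comp, ← MulHom.map_mclosure, Subsemigroup.coe_map]
  exact hs.denseRange.dense_image hf hA

section
variable {K : Type*} [RCLike K] {n : ℕ}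

/-- The functional is found by solving `v i ⬝ᵥ c = 1` for all `i` if `v` is a basis, and in the
annihilator of `v` otherwise. -/
theorem exists_ne_zero_forall_dotProduct_nonneg {k : ℕ} (hn : 0 < n) (hk : k ≤ n)
    (v : Fin k → Fin n → ℝ) : ∃ c : Fin n → ℝ, c ≠ 0 ∧ ∀ i, 0 ≤ v i ⬝ᵥ c := by
  let T : (Fin n → ℝ) →ₗ[ℝ] (Fin k → ℝ) := Matrix.mulVecLin (Matrix.of v)
  by_cases hT : Function.Injective T
  · have h1 := LinearMap.finrank_le_finrank_of_injective hT
    simp only [Module.finrank_fin_fun] at h1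
    obtain rfl : k = n := le_antisymm hk h1
    obtain ⟨c, hc⟩ := LinearMap.injective_iff_surjective.1 hT 1
    refine ⟨c, ?_, fun i => ?_⟩
    · rintro rfl
      have := congrFun hc ⟨0, hn⟩
      simp at this
    · have : v i ⬝ᵥ c = 1 := congrFun hc i
      rw [this]; exact zero_le_one
  · rw [← LinearMap.ker_eq_bot, Submodule.eq_bot_iff] at hT
    push Not at hT
    obtain ⟨c, hc, hc0⟩ := hT
    refine ⟨c, hc0, fun i => ?_⟩
    have : v i ⬝ᵥ c = 0 := congrFun (LinearMap.mem_ker.1 hc) i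
    exact this.ge

theorem lt_of_hasDenseSubsemigroupGeneratedBy_diagonalMatrices {k : ℕ}
    (h : HasDenseSubsemigroupGeneratedBy (diagonalMatrices K n) k) : n < k := by
  by_contra! hk
  obtain ⟨A, hA⟩ := h
  rcases Nat.eq_zero_or_pos n with rfl | hn
  · obtain rfl : k = 0 := by omega
    have := hA.nonempty_iff.2 ⟨⟨0, isDiag_zero⟩⟩
    simp at this
  obtain ⟨c, hc0, hc⟩ := exists_ne_zero_forall_dotProduct_nonneg hn hk
    fun i j => Real.log ‖(A i : Matrix (Fin n) (Fin n) K) j j‖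
  let φ : diagonalMatrices K n → ℝ := fun M => ∑ j, Real.log ‖(M : Matrix (Fin n) (Fin n) K) j j‖ * c j
  have hmul : ∀ (M N : diagonalMatrices K n) j, ((M * N : diagonalMatrices K n) :
      Matrix (Fin n) (Fin n) K) j j =
      (M : Matrix (Fin n) (Fin n) K) j j * (N : Matrix (Fin n) (Fin n) K) j j := by
    intro M N j
    rw [MulMemClass.coe_mul, mul_apply, Finset.sum_eq_single j (fun l _ hl => by
      rw [M.2 hl.symm, zero_mul]) (by simp)]
  -- Singular products are set aside, so the value `Real.log 0 = 0` in `φ` plays no role.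
  have hclos : ∀ M ∈ Subsemigroup.closure (Set.range A),
      (∃ j, (M : Matrix (Fin n) (Fin n) K) j j = 0) ∨ 0 ≤ φ M := by
    intro M hM
    induction hM using Subsemigroup.closure_induction with
    | mem x hx =>
      obtain ⟨i, rfl⟩ := hx
      exact Or.inr (hc i)
    | mul x y _ _ hx hy =>
      rcases hx with ⟨j, hj⟩ | hx
      · exact Or.inl ⟨j, by rw [hmul, hj, zero_mul]⟩
      rcases hy with ⟨j, hj⟩ | hy
      · exact Or.inl ⟨j, by rw [hmul, hj, mul_zero]⟩
      by_cases h0 : ∃ j, ((x * y : diagonalMatrices K n) : Matrix (Fin n) (Fin n) K) j j = 0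
      · exact Or.inl h0
      · push Not at h0
        refine Or.inr ?_
        have : φ (x * y) = φ x + φ y := by
          simp only [φ, ← Finset.sum_add_distrib]
          refine Finset.sum_congr rfl fun j _ => ?_
          have h1 := h0 j
          rw [hmul] at h1
          rw [hmul, norm_mul, Real.log_mul (norm_ne_zero_iff.2 (left_ne_zero_of_mul h1))
            (norm_ne_zero_iff.2 (right_ne_zero_of_mul h1)), add_mul]
        rw [this]
        exact add_nonneg hx hy
  have hcont : ∀ j, Continuous fun M : diagonalMatrices K n => (M : Matrix (Fin n) (Fin n) K) j j :=
    fun j => continuous_subtype_val.matrix_elem j j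
  have hopen : IsOpen {M : diagonalMatrices K n |
      (∀ j, (M : Matrix (Fin n) (Fin n) K) j j ≠ 0) ∧ φ M < 0} := by
    have hU : IsOpen {M : diagonalMatrices K n | ∀ j, (M : Matrix (Fin n) (Fin n) K) j j ≠ 0} := by
      simp only [Set.ofPred_forall]
      exact isOpen_iInter_of_finite fun j => isOpen_ne_fun (hcont j) continuous_const
    refine ContinuousOn.isOpen_inter_preimage (f := φ) (t := Set.Iio 0) ?_ hU isOpen_Iio
    refine continuousOn_finsetSum _ fun j _ => ContinuousOn.mul ?_ continuousOn_const
    exact ((hcont j).norm.continuousOn).log fun M hM => norm_ne_zero_iff.2 (hM j)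
  obtain ⟨M, ⟨hM0, hMφ⟩, hM⟩ := hA.inter_open_nonempty _ hopen
    ⟨⟨diagonal fun j => ((Real.exp (-c j) : ℝ) : K), isDiag_diagonal _⟩, by
      refine ⟨fun j => by simp, ?_⟩
      have h1 : 0 < c ⬝ᵥ c := by
        refine lt_of_le_of_ne (Finset.sum_nonneg fun j _ => mul_self_nonneg _) fun h => hc0 ?_
        exact dotProduct_self_eq_zero.1 h.symm
      simp only [φ, diagonal_apply_eq, RCLike.norm_ofReal, abs_of_pos (Real.exp_pos _),
        Real.log_exp]
      simpa [dotProduct] using h1⟩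
  rcases hclos M hM with ⟨j, hj⟩ | h
  · exact hM0 j hj
  · exact absurd h (not_le.2 hMφ)

/-! ### Generators and the diagonal part -/

theorem hasDenseSubsemigroupGeneratedBy_lowerTriangularMatrices :
    HasDenseSubsemigroupGeneratedBy (lowerTriangularMatrices K n) (n + 1) := by
  obtain ⟨d, A, hd, hda, hA, hAa, hdense⟩ := exists_dense_diagonal_semigroup K n
  have hPl : (unipotentBidiagonal K n).IsLowerTriangular := isLowerTriangular_unipotentBidiagonal
  have : Invertible (unipotentBidiagonal K n) :=
    invertibleOfIsUnitDet _ isUnit_det_unipotentBidiagonal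
  have hPil : (unipotentBidiagonal K n)⁻¹.IsLowerTriangular :=
    blockTriangular_inv_of_blockTriangular hPl
  let G : Fin (n + 1) → lowerTriangularMatrices K n :=
    Fin.cons ⟨unipotentBidiagonal K n * diagonal d * (unipotentBidiagonal K n)⁻¹,
      (hPl.mul (blockTriangular_diagonal d)).mul hPil⟩
      fun i => ⟨diagonal (A i), blockTriangular_diagonal (A i)⟩
  refine ⟨G, Subtype.dense_iff.2 fun M hM => ?_⟩
  let S := ((Subsemigroup.closure (Set.range G)).map
    (MulMemClass.subtype (lowerTriangularMatrices K n))).topologicalClosure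
  have hG : ∀ i, (G i : Matrix (Fin n) (Fin n) K) ∈ S := fun i =>
    Subsemigroup.le_topologicalClosure _
      ⟨G i, Subsemigroup.subset_closure (Set.mem_range_self i), rfl⟩
  exact mem_of_isLowerTriangular_of_generators (S := S)
    (Subsemigroup.isClosed_topologicalClosure _) hd hda hA hAa hdense (hG 0)
    (fun i => hG i.succ) hM

/-- Taking the diagonal part of a lower triangular matrix, as a homomorphism of semigroups. -/
def lowerTriangularMatrices.diagonalPart (K : Type*) [Semiring K] (n : ℕ) :
    lowerTriangularMatrices K n →ₙ* diagonalMatrices K n where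
  toFun M := ⟨diagonal (M : Matrix (Fin n) (Fin n) K).diag, isDiag_diagonal _⟩
  map_mul' M N := by
    refine Subtype.ext ?_
    simp only [MulMemClass.coe_mul, diagonal_mul_diagonal]
    congr 1
    ext i
    exact M.2.mul_apply_self N.2 i

theorem lowerTriangularMatrices.continuous_diagonalPart :
    Continuous (diagonalPart K n) :=
  (continuous_subtype_val.matrix_diag.matrix_diagonal).subtype_mk _

theorem lowerTriangularMatrices.surjective_diagonalPart :
    Function.Surjective (diagonalPart K n) := by
  rintro ⟨M, hM⟩
  refine ⟨⟨M, fun i j h => hM (OrderDual.toDual_lt_toDual.1 h).ne⟩, Subtype.ext ?_⟩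
  exact hM.diagonal_diag

end

theorem theorem1 (K : Type*) [RCLike K] (n : ℕ) :
    IsLeast {k : ℕ | HasDenseSubsemigroupGeneratedBy (lowerTriangularMatrices K n) k} (n + 1) ∧
      IsLeast {k : ℕ | HasDenseSubsemigroupGeneratedBy (diagonalMatrices K n) k} (n + 1) := by
  have hT := hasDenseSubsemigroupGeneratedBy_lowerTriangularMatrices (K := K) (n := n)
  have hTD : ∀ k, HasDenseSubsemigroupGeneratedBy (lowerTriangularMatrices K n) k →
      HasDenseSubsemigroupGeneratedBy (diagonalMatrices K n) k := fun k h =>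
    h.of_surjective (lowerTriangularMatrices.diagonalPart K n)
      lowerTriangularMatrices.continuous_diagonalPart
      lowerTriangularMatrices.surjective_diagonalPart
  exact ⟨⟨hT, fun k hk => lt_of_hasDenseSubsemigroupGeneratedBy_diagonalMatrices (hTD k hk)⟩,
    hTD _ hT, fun k hk => lt_of_hasDenseSubsemigroupGeneratedBy_diagonalMatrices hk⟩
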